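/- **Deep Maximum Theorem: Convex Case.** Let $\sigma:\mathbb{R}\to\mathbb{R}$ be continuous, and differentiable at some point $x_0$ with $\sigma'(x_0)\neq 0$. Let $K\subseteq\mathbb{R}^m$ be non-empty and compact. Let $(C_x)_{x\in\mathbb{R}^n}$ be non-empty closed subsets of $\mathbb{R}^m$ with $C_x\cap K\neq\emptyset$ for every $x$, which are weakly measurable: $\{x: C_x\cap U\neq\emptyset\}$ is Borel for every relatively open $U\subseteq K$. Let $L:\mathbb{R}^n\times\mathbb{R}^m\to\mathbb{R}$ be continuous in $y$ and Borel measurable in $x$ (for instance, jointly continuous), and let $\mathbb{P}$ be a Borel probability measure on $\mathbb{R}^n$. Suppose that each $C_x\cap K$ is convex and that each $L(x,\cdot)$ is strictly convex on $\mathbb{R}^m$. Notation. A feedforward network $\hat f:\mathbb{R}^n\to\mathbb{R}^N$ is a composition of finitely many layers $z\mapsto\sigma(Az+b)$ ($\sigma$ applied coordinatewise) followed by a linear map $z\mapsto Az$; its width is the largest dimension of its layers, input and output included. $\operatorname{Softmax}_N(w)_k=e^{w_k}/\sum_j e^{w_j}$; for an $N\times m$ matrix $Y$ with rows $Y_k$,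 $\operatorname{Attention}(w,Y)=\sum_k\operatorname{Softmax}_N(w)_kY_k$; for an $N\times Q\times m$ array $y=(y_{k,q})$ of points of $\mathbb{R}^m$, $\operatorname{P-attention}(w,y)=\frac1Q\sum_{k,q}\operatorname{Softmax}_N(w)_k\,\delta_{y_{k,q}}$. $\mathcal{W}_1$ is the Wasserstein-1 distance, and $\mathcal{W}_1(\mu,B)=\inf_{b\in B}\mathcal{W}_1(\mu,\delta_b)$ for a set $B$. For $0<\epsilon\le1$, say that a network $\hat f:\mathbb{R}^n\to\mathbb{R}^N$ of width at most $2+n+N$, an array $y$ as above, and a compact set $\mathcal{X}_\epsilon\subseteq\mathbb{R}^n$ are *$\epsilon$-optimal* if the measures $\hat F(x)=\operatorname{P-attention}(\hat f(x),y)$ satisfy $\bigcup_{x\in\mathbb{R}^n}\operatorname{supp}\hat F(x)\subseteq K$, $\mathcal{W}_1\big(\hat F(x),\operatorname{argmin}_{z\in C_x\cap K}L(x,z)\big)\le\epsilon$ for all $x\in\mathcal{X}_\epsilon$, and $1-\mathbb{P}(\mathcal{X}_\epsilon)\le\epsilon$. Then for every $x\in\mathbb{R}^n$ the function $L(x,\cdot)$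 has a unique minimizer $y^\star(x)$ on $C_x\cap K$, and for every $0<\epsilon\le1$: (1) there are $N\ge1$, a network $\hat f$, an $N\times m$ matrix of particles (that is, an array with $Q=1$) and a compact set $\mathcal{X}_\epsilon$ which are $\epsilon$-optimal; (2) for all $N,Q\ge1$, all $\epsilon$-optimal $(\hat f,y,\mathcal{X}_\epsilon)$ and every $\mathbb{R}^m$-valued random field $(Y^x)_{x\in\mathbb{R}^n}$ with $Y^x\sim\hat F(x)$, each $Y^x$ is integrable and $$\mathbb{E}[Y^x]=\operatorname{Attention}(\hat f(x),Y)\quad\text{for all }x\in\mathbb{R}^n,\qquad\text{where } Y=\Big(\tfrac1Q\sum_{q=1}^Q y_{k,q}\Big)_{k=1}^N;$$ moreover (i) if $K$ is convex, then $\mathbb{E}[Y^x]\in K$ for all $x\in\mathbb{R}^n$; and (ii) $\|\mathbb{E}[Y^x]-y^\star(x)\|\le\epsilon$ for all $x\in\mathcal{X}_\epsilon$. -/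

import Mathlib

open MeasureTheory ProbabilityTheory
open scoped ENNReal

noncomputable section

/-- The Euclidean space `ℝᵈ`. -/
abbrev Euc (d : ℕ) : Type := EuclideanSpace ℝ (Fin d)

/-- The assumption on the activation function: `σ` is continuous, and it is differentiable at some
point with non-zero derivative there. -/
def AdmissibleActivation (σ : ℝ → ℝ) : Prop :=
  Continuous σ ∧ ∃ x₀ : ℝ, DifferentiableAt ℝ σ x₀ ∧ deriv σ x₀ ≠ 0

/-- Parameters of a feedforward network with `n` inputs and `N` outputs: finitely many hidden
layers, each given by a weight matrix and a bias vector, followed by a linear readout. -/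
inductive Network : ℕ → ℕ → Type
  | readout {n N : ℕ} (A : Matrix (Fin N) (Fin n) ℝ) : Network n N
  | layer {n d N : ℕ} (A : Matrix (Fin d) (Fin n) ℝ) (b : Fin d → ℝ) (rest : Network d N) :
      Network n N

namespace Network

/-- The function computed by a network with activation function `σ`; a hidden layer is
`x ↦ σ (A x + b)`, with `σ` applied coordinatewise. -/
def eval (σ : ℝ → ℝ) : {n N : ℕ} → Network n N → (Fin n → ℝ) → (Fin N → ℝ)
  | _, _, readout A, x => A.mulVec x
  | _, _, layer A b rest, x => eval σ rest (fun i => σ (A.mulVec x i + b i))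

/-- The width: the largest dimension of a layer, input and output layer included. -/
def width : {n N : ℕ} → Network n N → ℕ
  | n, N, readout _ => max n N
  | n, _, layer _ _ rest => max n (width rest)

end Network

/-- `Softmax_N`. -/
def softmax {N : ℕ} (w : Fin N → ℝ) (k : Fin N) : ℝ :=
  Real.exp (w k) / ∑ j, Real.exp (w j)

/-- `Attention(w, Y)`, the rows of the `N × m` matrix `Y` being the points `Y k` of `ℝᵐ`. -/
def attention {N m : ℕ} (w : Fin N → ℝ) (Y : Fin N → Euc m) : Euc m :=
  ∑ k, softmax w k • Y k

/-- `P-attention(w, Y)` for an `N × Q × m` array `Y`; an `N × m` matrix is the case `Q = 1`. -/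
def pAttention {N Q m : ℕ} (w : Fin N → ℝ) (Y : Fin N → Fin Q → Euc m) : Measure (Euc m) :=
  (Q : ℝ≥0∞)⁻¹ • ∑ k, ∑ q, ENNReal.ofReal (softmax w k) • Measure.dirac (Y k q)

/-- The `N × m` matrix of averaged particles. -/
def averagedParticles {N Q m : ℕ} (Y : Fin N → Fin Q → Euc m) (k : Fin N) : Euc m :=
  (Q : ℝ)⁻¹ • ∑ q, Y k q

/-- The Wasserstein-1 distance: the infimum of the transport cost over all couplings. -/
def W1 {m : ℕ} (μ ν : Measure (Euc m)) : ℝ≥0∞ :=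
  ⨅ (π : Measure (Euc m × Euc m)) (_ : π.map Prod.fst = μ ∧ π.map Prod.snd = ν),
    ∫⁻ p, edist p.1 p.2 ∂π

/-- The Wasserstein-1 distance of a measure to (the point masses at the points of) a set. -/
def W1ToSet {m : ℕ} (μ : Measure (Euc m)) (B : Set (Euc m)) : ℝ≥0∞ :=
  ⨅ b ∈ B, W1 μ (Measure.dirac b)

/-- `C` is a weakly measurable correspondence, relative to `K`: its values are non-empty and, for
every relatively open subset `U ∩ K` of `K`, the set of all `x` such that `C x` meets `U ∩ K` is
Borel. -/
def WeaklyMeasurableCorrespondence {n m : ℕ} (K : Set (Euc m)) (C : Euc n → Set (Euc m)) : Prop :=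
  (∀ x, (C x).Nonempty) ∧
    ∀ U : Set (Euc m), IsOpen U → MeasurableSet {x | (C x ∩ (U ∩ K)).Nonempty}

/-- The set of minimizers of `f` on `S`. -/
def argminOn {m : ℕ} (f : Euc m → ℝ) (S : Set (Euc m)) : Set (Euc m) :=
  {y | y ∈ S ∧ ∀ z ∈ S, f y ≤ f z}

/-- The model `F̂(x) = P-attention(f̂(x), Y)`, for a network `f̂` and an array `Y`. -/
def model {n N Q m : ℕ} (σ : ℝ → ℝ) (f : Network n N) (Y : Fin N → Fin Q → Euc m) (x : Euc n) :
    Measure (Euc m) :=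
  pAttention (f.eval σ x.ofLp) Y

/-- The network `f`, the particles `Y` and the set `X` solve the constrained optimization problem up
to `ε`: the model is supported in `K`, and on the compact set `X`, whose complement has probability
at most `ε`, it is `ε`-close to the set of minimizers of `L x` on `C x ∩ K`. -/
structure ProbablyApproximatelyOptimal {n m N Q : ℕ} (σ : ℝ → ℝ) (K : Set (Euc m))
    (C : Euc n → Set (Euc m)) (L : Euc n → Euc m → ℝ) (P : Measure (Euc n)) (ε : ℝ)
    (f : Network n N) (Y : Fin N → Fin Q → Euc m) (X : Set (Euc n)) : Prop where
  width_le : f.width ≤ 2 + n + N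
  support_subset : (⋃ x, (model σ f Y x).support) ⊆ K
  isCompact : IsCompact X
  optimal : ∀ x ∈ X, W1ToSet (model σ f Y x) (argminOn (L x) (C x ∩ K)) ≤ ENNReal.ofReal ε
  prob : 1 - P.real X ≤ ε

end

/-!
The unique minimizer `ystar x` depends measurably on `x`, so by Lusin's theorem `ystar` is
continuous on a compact set `X` of probability at least `1 - ε`. Let the centres `c k` form a finite
net of `X` and give the particle `ystar (c k)` the score `-λ ‖x - c k‖²`. For large `λ`, softmax
puts almost all the mass on the centres near `x`, and uniform continuity of `ystar` on `X` makes the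
resulting measure close to the point mass at `ystar x`. Up to the summand `-λ ‖x‖²`, which softmax
ignores, the scores are affine in `x`; and a network with one hidden layer approximates any affine
map uniformly on bounded sets, since the difference quotients of `σ` at `x₀` converge to a non-zero
linear map.

The bound on the mean is Jensen's inequality: the `W1`-distance from a probability measure to the
point mass at `b` is the mean distance to `b`, which bounds the distance from the mean to `b`.
-/

open Filter Topology Matrix

section Lusin

variable {X Y : Type*} [TopologicalSpace X] [T2Space X] [MeasurableSpace X]
  [OpensMeasurableSpace X] [TopologicalSpace Y] [SecondCountableTopology Y] [MeasurableSpace Y]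
  [OpensMeasurableSpace Y]

lemma exists_isCompact_isCompact_measure_compl_union_lt (μ : Measure X) [IsFiniteMeasure μ]
    [μ.InnerRegularCompactLTTop] {A : Set X} (hA : MeasurableSet A) {ε : ℝ≥0∞} (hε : ε ≠ 0) :
    ∃ s t : Set X, IsCompact s ∧ IsCompact t ∧ s ⊆ A ∧ t ⊆ Aᶜ ∧ μ (s ∪ t)ᶜ < ε := by
  have hε2 : ε / 2 ≠ 0 := (ENNReal.half_pos hε).ne'
  obtain ⟨s, hsA, hs, hμs⟩ := hA.exists_isCompact_sdiff_lt (measure_ne_top μ A) hε2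
  obtain ⟨t, htA, ht, hμt⟩ := hA.compl.exists_isCompact_sdiff_lt (measure_ne_top μ Aᶜ) hε2
  refine ⟨s, t, hs, ht, hsA, htA, ?_⟩
  have hsub : (s ∪ t)ᶜ ⊆ A \ s ∪ Aᶜ \ t := fun x hx => by
    by_cases hxA : x ∈ A <;> simp_all
  calc μ (s ∪ t)ᶜ ≤ μ (A \ s) + μ (Aᶜ \ t) := (measure_mono hsub).trans (measure_union_le _ _)
    _ < ε / 2 + ε / 2 := ENNReal.add_lt_add hμs hμt
    _ = ε := ENNReal.add_halves ε

theorem exists_isCompact_measure_compl_lt_continuousOn (μ : Measure X) [IsFiniteMeasure μ]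
    [μ.InnerRegularCompactLTTop] {g : X → Y} (hg : Measurable g) {ε : ℝ≥0∞} (hε : ε ≠ 0) :
    ∃ s : Set X, IsCompact s ∧ μ sᶜ < ε ∧ ContinuousOn g s := by
  cases isEmpty_or_nonempty X with
  | inl _ => exact ⟨∅, isCompact_empty, by simpa [Set.eq_empty_of_isEmpty] using hε.bot_lt, by simp⟩
  | inr hX =>
  have hb := TopologicalSpace.isBasis_countableBasis Y
  let ι := TopologicalSpace.countableBasis Y
  have : Nonempty ι := by
    obtain ⟨B, hB, -⟩ := hb.exists_subset_of_mem_open (Set.mem_univ (g hX.some)) isOpen_univ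
    exact ⟨B, hB⟩
  obtain ⟨ε', hε', hsum⟩ := ENNReal.exists_pos_sum_of_countable hε ι
  choose s t hs ht hsB htB hμ using fun B : ι =>
    exists_isCompact_isCompact_measure_compl_union_lt μ (hg (hb.isOpen B.2).measurableSet)
      (ENNReal.coe_ne_zero.2 (hε' B).ne')
  have hst (B : ι) : IsCompact (s B ∪ t B) := (hs B).union (ht B)
  refine ⟨⋂ B, (s B ∪ t B), ?_, ?_, ?_⟩
  · exact (hst (Classical.arbitrary ι)).of_isClosed_subset
      (isClosed_iInter fun B => (hst B).isClosed) (Set.iInter_subset _ _)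
  · calc μ (⋂ B, (s B ∪ t B))ᶜ ≤ ∑' B, μ (s B ∪ t B)ᶜ := by
          rw [Set.compl_iInter]
          exact measure_iUnion_le _
      _ ≤ ∑' B, (ε' B : ℝ≥0∞) := ENNReal.tsum_le_tsum fun B => (hμ B).le
      _ < ε := hsum
  · rw [continuousOn_iff_continuous_domRestrict, hb.continuous_iff]
    intro B hB
    -- On the compact set, lying over `B` is the same as avoiding the closed set `t B`.
    have hpre : (⋂ B, (s B ∪ t B)).domRestrict g ⁻¹' B = Subtype.val ⁻¹' (t ⟨B, hB⟩)ᶜ := by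
      ext ⟨x, hx⟩
      refine ⟨fun hxB hxt => htB ⟨B, hB⟩ hxt hxB, fun hxt => ?_⟩
      exact hsB ⟨B, hB⟩ ((Set.mem_iInter.1 hx ⟨B, hB⟩).resolve_right hxt)
    rw [hpre]
    exact (ht ⟨B, hB⟩).isClosed.isOpen_compl.preimage continuous_subtype_val

end Lusin

section MeasurableMaximum

variable {α β : Type*} [MeasurableSpace α] {f : α → β → ℝ} {S : α → Set β}

lemma measurableSet_forall_mem_le [TopologicalSpace β] [SecondCountableTopology β]
    (hf : ∀ x, LowerSemicontinuous (f x)) (hfm : ∀ y, Measurable fun x => f x y)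
    (B : Set β) (r : ℝ) : MeasurableSet {x | ∀ y ∈ B, f x y ≤ r} := by
  obtain ⟨D, hDc, hD⟩ := TopologicalSpace.exists_countable_dense B
  have heq : {x | ∀ y ∈ B, f x y ≤ r} = ⋂ y ∈ D, {x | f x y ≤ r} := by
    ext x
    simp only [Set.mem_ofPred_eq, Set.mem_iInter]
    refine ⟨fun h y _ => h y y.2, fun h y hy => ?_⟩
    exact closure_minimal (t := Subtype.val ⁻¹' {z | f x z ≤ r}) h
      (((hf x).isClosed_preimage r).preimage continuous_subtype_val) (hD ⟨y, hy⟩)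
  rw [heq]
  exact .biInter hDc fun y _ => measurableSet_le (hfm y) measurable_const

lemma measurableSet_exists_mem_lt [TopologicalSpace β] [SecondCountableTopology β]
    (hS : ∀ U, IsOpen U → MeasurableSet {x | (S x ∩ U).Nonempty})
    (hf : ∀ x, Continuous (f x)) (hfm : ∀ y, Measurable fun x => f x y)
    {V : Set β} (hV : IsOpen V) {t : α → ℝ} (ht : Measurable t) :
    MeasurableSet {x | ∃ y ∈ S x ∩ V, f x y < t x} := by
  have hb := TopologicalSpace.isBasis_countableBasis β
  have heq : {x | ∃ y ∈ S x ∩ V, f x y < t x} =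
      ⋃ B ∈ TopologicalSpace.countableBasis β, ⋃ (_ : B ⊆ V), ⋃ r : ℚ,
        {x | (S x ∩ B).Nonempty} ∩ {x | ∀ y ∈ B, f x y ≤ r} ∩ {x | r < t x} := by
    ext x
    simp only [Set.mem_ofPred_eq, Set.mem_iUnion, Set.mem_inter_iff, exists_prop]
    constructor
    · rintro ⟨y, ⟨hyS, hyV⟩, hyt⟩
      obtain ⟨r, hyr, hrt⟩ := exists_rat_btwn hyt
      obtain ⟨B, hB, hyB, hBV⟩ := hb.exists_subset_of_mem_open
        (show y ∈ V ∩ {z | f x z < r} from ⟨hyV, hyr⟩)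
        (hV.inter (isOpen_lt (hf x) continuous_const))
      exact ⟨B, hB, fun z hz => (hBV hz).1, r, ⟨⟨y, hyS, hyB⟩, fun z hz => (hBV hz).2.le⟩, hrt⟩
    · rintro ⟨B, -, hBV, r, ⟨⟨y, hyS, hyB⟩, hle⟩, hrt⟩
      exact ⟨y, ⟨hyS, hBV hyB⟩, (hle y hyB).trans_lt hrt⟩
  rw [heq]
  refine .biUnion (TopologicalSpace.countable_countableBasis β) fun B hB => .iUnion fun _ =>
    .iUnion fun r => .inter (.inter (hS B (hb.isOpen hB)) ?_) (measurableSet_lt measurable_const ht)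
  exact measurableSet_forall_mem_le (fun x => (hf x).lowerSemicontinuous) hfm B r

lemma measurable_apply_of_isMinOn [TopologicalSpace β] [SecondCountableTopology β]
    (hS : ∀ U, IsOpen U → MeasurableSet {x | (S x ∩ U).Nonempty})
    (hf : ∀ x, Continuous (f x)) (hfm : ∀ y, Measurable fun x => f x y)
    {g : α → β} (hgS : ∀ x, g x ∈ S x) (hgmin : ∀ x, IsMinOn (f x) (S x) (g x)) :
    Measurable fun x => f x (g x) := by
  refine measurable_of_Iio fun t => ?_
  convert measurableSet_exists_mem_lt hS hf hfm isOpen_univ (measurable_const (a := t)) using 1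
  ext x
  exact ⟨fun h => ⟨g x, ⟨hgS x, trivial⟩, h⟩,
    fun ⟨_, hy, hyt⟩ => (isMinOn_iff.1 (hgmin x) _ hy.1).trans_lt hyt⟩

lemma exists_mem_inter_le_of_forall_exists_mem_thickening [PseudoMetricSpace β]
    {s F : Set β} (hs : IsCompact s) (hF : IsClosed F) {h : β → ℝ} (hh : Continuous h) {v : ℝ}
    (H : ∀ k : ℕ, ∃ y ∈ s ∩ Metric.thickening (1 / (k + 1)) F, h y < v + 1 / (k + 1)) :
    ∃ y ∈ s ∩ F, h y ≤ v := by
  choose u hu huv using H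
  choose z hzF hdist using fun k => Metric.mem_thickening_iff.1 (hu k).2
  obtain ⟨y, hys, φ, hφ, huy⟩ := hs.tendsto_subseq fun k => (hu k).1
  have hlim : Tendsto (fun k => 1 / ((φ k : ℝ) + 1)) atTop (𝓝 0) :=
    tendsto_one_div_add_atTop_nhds_zero_nat.comp hφ.tendsto_atTop
  have hzy : Tendsto (z ∘ φ) atTop (𝓝 y) := huy.congr_dist <|
    squeeze_zero (fun _ => dist_nonneg) (fun k => (hdist (φ k)).le) hlim
  refine ⟨y, ⟨hys, hF.mem_of_tendsto hzy (.of_forall fun k => hzF (φ k))⟩, ?_⟩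
  refine le_of_tendsto_of_tendsto' ((hh.tendsto y).comp huy) ?_ fun k => (huv (φ k)).le
  simpa only [add_zero] using hlim.const_add v

theorem measurable_of_unique_isMinOn [PseudoMetricSpace β] [SecondCountableTopology β]
    [MeasurableSpace β] [BorelSpace β] (hScpt : ∀ x, IsCompact (S x))
    (hS : ∀ U, IsOpen U → MeasurableSet {x | (S x ∩ U).Nonempty})
    (hf : ∀ x, Continuous (f x)) (hfm : ∀ y, Measurable fun x => f x y)
    {g : α → β} (hgS : ∀ x, g x ∈ S x) (hgmin : ∀ x, IsMinOn (f x) (S x) (g x))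
    (hguniq : ∀ x, ∀ y ∈ S x, IsMinOn (f x) (S x) y → y = g x) : Measurable g := by
  refine measurable_of_isClosed fun F hF => ?_
  -- By compactness, a point of `F` is minimal as soon as points near `F` are nearly minimal.
  have heq : g ⁻¹' F = ⋂ k : ℕ,
      {x | ∃ y ∈ S x ∩ Metric.thickening (1 / (k + 1)) F, f x y < f x (g x) + 1 / (k + 1)} := by
    ext x
    rw [Set.mem_iInter]
    constructor
    · intro hx k
      have hk : (0 : ℝ) < 1 / (k + 1) := Nat.one_div_pos_of_nat
      exact ⟨g x, ⟨hgS x, Metric.self_subset_thickening hk F hx⟩, lt_add_of_pos_right _ hk⟩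
    · intro hx
      obtain ⟨y, ⟨hyS, hyF⟩, hyle⟩ :=
        exists_mem_inter_le_of_forall_exists_mem_thickening (hScpt x) hF (hf x) hx
      have hymin : IsMinOn (f x) (S x) y :=
        isMinOn_iff.2 fun z hz => hyle.trans (isMinOn_iff.1 (hgmin x) z hz)
      rwa [Set.mem_preimage, ← hguniq x y hyS hymin]
  rw [heq]
  exact .iInter fun k => measurableSet_exists_mem_lt hS hf hfm Metric.isOpen_thickening
    ((measurable_apply_of_isMinOn hS hf hfm hgS hgmin).add_const _)

end MeasurableMaximum

section Argmin

variable {m : ℕ}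

lemma mem_argminOn_iff {f : Euc m → ℝ} {S : Set (Euc m)} {y : Euc m} :
    y ∈ argminOn f S ↔ y ∈ S ∧ IsMinOn f S y := by
  simp only [argminOn, Set.mem_ofPred_eq, isMinOn_iff]

lemma exists_argminOn_eq_singleton {f : Euc m → ℝ} {S : Set (Euc m)} (hS : IsCompact S)
    (hne : S.Nonempty) (hf : LowerSemicontinuousOn f S) (hconv : StrictConvexOn ℝ S f) :
    ∃ y, argminOn f S = {y} := by
  obtain ⟨y, hyS, hy⟩ := hf.exists_isMinOn hne hS
  refine ⟨y, Set.eq_singleton_iff_unique_mem.2 ⟨mem_argminOn_iff.2 ⟨hyS, hy⟩, fun z hz => ?_⟩⟩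
  obtain ⟨hzS, hzmin⟩ := mem_argminOn_iff.1 hz
  exact hconv.eq_of_isMinOn hzmin hy hzS hyS

lemma measurable_of_argminOn_eq_singleton {n : ℕ} {K : Set (Euc m)} (hK : IsCompact K)
    {C : Euc n → Set (Euc m)} (hC : WeaklyMeasurableCorrespondence K C)
    (hCK : ∀ x, IsClosed (C x ∩ K)) {L : Euc n → Euc m → ℝ} (hL : ∀ x, ContinuousOn (L x) K)
    (hLm : ∀ y ∈ K, Measurable fun x => L x y) {ystar : Euc n → Euc m}
    (hy : ∀ x, argminOn (L x) (C x ∩ K) = {ystar x}) : Measurable ystar := by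
  have hmem x : ystar x ∈ argminOn (L x) (C x ∩ K) := hy x ▸ rfl
  have : CompactSpace K := isCompact_iff_compactSpace.1 hK
  let S : Euc n → Set K := fun x => Subtype.val ⁻¹' (C x ∩ K)
  have hS : ∀ U : Set K, IsOpen U → MeasurableSet {x | (S x ∩ U).Nonempty} := by
    intro U hU
    obtain ⟨V, hV, rfl⟩ := isOpen_induced_iff.1 hU
    convert hC.2 V hV using 3
    exact ⟨fun ⟨y, hyS, hyV⟩ => ⟨y, hyS.1, hyV, y.2⟩,
      fun ⟨y, hyC, hyV, hyK⟩ => ⟨⟨y, hyK⟩, ⟨hyC, hyK⟩, hyV⟩⟩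
  let g : Euc n → K := fun x => ⟨ystar x, (hmem x).1.2⟩
  suffices Measurable g from measurable_subtype_coe.comp this
  refine measurable_of_unique_isMinOn (β := K) (f := fun x y => L x y) (S := S)
    (fun x => ((hCK x).preimage continuous_subtype_val).isCompact) hS
    (fun x => (hL x).domRestrict) (fun y => hLm y y.2) (fun x => (hmem x).1)
    (fun x => isMinOn_iff.2 fun z hz => (hmem x).2 z hz) fun x y hyS hymin => Subtype.ext ?_
  have hyarg : (y : Euc m) ∈ argminOn (L x) (C x ∩ K) :=
    ⟨hyS, fun z hz => isMinOn_iff.1 hymin ⟨z, hz.2⟩ hz⟩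
  simpa only [hy x, Set.mem_singleton_iff] using hyarg

end Argmin

section DifferenceQuotient

lemma tendstoUniformlyOn_inv_smul_sub_of_hasFDerivAt {𝕜 E F : Type*} [NontriviallyNormedField 𝕜]
    [NormedAddCommGroup E] [NormedSpace 𝕜 E] [NormedAddCommGroup F] [NormedSpace 𝕜 F]
    {f : E → F} {f' : E →L[𝕜] F} {x : E} (hf : HasFDerivAt f f' x) {s : Set E}
    (hs : Bornology.IsBounded s) :
    TendstoUniformlyOn (fun (δ : 𝕜) v => δ⁻¹ • (f (x + δ • v) - f x)) f' (𝓝[≠] 0) s := by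
  rw [Metric.tendstoUniformlyOn_iff]
  intro ε hε
  obtain ⟨R, hR, hsR⟩ := hs.exists_pos_norm_le
  obtain ⟨ρ, hρ, hlittle⟩ := Metric.eventually_nhds_iff_ball.1 <|
    hf.isLittleO.def (show 0 < ε / (2 * R) by positivity)
  have hsmall : ∀ᶠ δ in 𝓝[≠] (0 : 𝕜), ‖δ‖ < ρ / R := nhdsWithin_le_nhds <| by
    simpa only [Metric.ball, dist_zero_right] using Metric.ball_mem_nhds (0 : 𝕜) (div_pos hρ hR)
  filter_upwards [hsmall, self_mem_nhdsWithin] with δ hδρ hδ v hv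
  have hδ0 : 0 < ‖δ‖ := norm_pos_iff.2 hδ
  have hball : x + δ • v ∈ Metric.ball x ρ := by
    rw [mem_ball_iff_norm, add_sub_cancel_left, norm_smul]
    calc ‖δ‖ * ‖v‖ ≤ ‖δ‖ * R := by gcongr; exact hsR v hv
      _ < ρ := (lt_div_iff₀ hR).1 hδρ
  have hrem := hlittle _ hball
  rw [add_sub_cancel_left, map_smul, norm_smul] at hrem
  have hquot : δ⁻¹ • (f (x + δ • v) - f x) - f' v =
      δ⁻¹ • (f (x + δ • v) - f x - δ • f' v) := by
    rw [smul_sub δ⁻¹ (_ - _), inv_smul_smul₀ hδ]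
  rw [dist_comm, dist_eq_norm, hquot, norm_smul, norm_inv, inv_mul_lt_iff₀ hδ0]
  calc ‖f (x + δ • v) - f x - δ • f' v‖ ≤ ε / (2 * R) * (‖δ‖ * R) := by
        grw [hrem, hsR v hv]
    _ = ‖δ‖ * (ε / 2) := by field_simp
    _ < ‖δ‖ * ε := by gcongr; exact half_lt_self hε

lemma hasFDerivAt_pi_apply_const {ι 𝕜 : Type*} [Finite ι] [NontriviallyNormedField 𝕜]
    {σ : 𝕜 → 𝕜} {σ' x₀ : 𝕜} (hσ : HasDerivAt σ σ' x₀) :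
    HasFDerivAt (fun (z : ι → 𝕜) i => σ (z i)) (σ' • ContinuousLinearMap.id 𝕜 (ι → 𝕜))
      fun _ => x₀ := by
  cases nonempty_fintype ι
  rw [hasFDerivAt_pi']
  intro i
  exact (hσ.comp_hasFDerivAt (fun _ : ι => x₀) (hasFDerivAt_apply i _)).congr_fderiv rfl

end DifferenceQuotient

namespace Network

variable {σ' x₀ c : ℝ} {σ : ℝ → ℝ} {n N : ℕ}

/-- The network with one hidden layer which evaluates an affine map `z ↦ A z + b` at the difference
quotients `δ⁻¹ (σ (x₀ + δ zᵢ) - σ x₀)` in place of the coordinates `zᵢ`. As a readout has no bias,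
the hidden layer contains an additional neuron with the constant value `σ c`, which has to be
non-zero. -/
noncomputable def differenceQuotient (σ : ℝ → ℝ) (c x₀ δ : ℝ) (A : Matrix (Fin N) (Fin n) ℝ)
    (b : Fin N → ℝ) : Network n N :=
  .layer (Matrix.of (Fin.cons 0 fun i => Pi.single i δ)) (Fin.cons c fun _ => x₀)
    (.readout (Matrix.of fun k =>
      Fin.cons ((b k - ∑ i, A k i * (δ⁻¹ * σ x₀)) / σ c) fun i => A k i * δ⁻¹))

lemma width_differenceQuotient (σ : ℝ → ℝ) (c x₀ δ : ℝ) (A : Matrix (Fin N) (Fin n) ℝ)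
    (b : Fin N → ℝ) : (differenceQuotient σ c x₀ δ A b).width = max (n + 1) N := by
  simp only [differenceQuotient, width]
  omega

lemma eval_differenceQuotient (hc : σ c ≠ 0) (x₀ δ : ℝ) (A : Matrix (Fin N) (Fin n) ℝ)
    (b : Fin N → ℝ) (z : Fin n → ℝ) :
    (differenceQuotient σ c x₀ δ A b).eval σ z =
      (A *ᵥ fun i => δ⁻¹ * (σ (x₀ + δ * z i) - σ x₀)) + b := by
  ext k
  simp only [differenceQuotient, eval, Matrix.mulVec, dotProduct, Fin.sum_univ_succ,
    Matrix.of_apply, Fin.cons_zero, Fin.cons_succ, Pi.zero_apply, zero_mul, Finset.sum_const_zero,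
    zero_add, div_mul_cancel₀ _ hc, Pi.single_apply, ite_mul, Finset.sum_ite_eq', Finset.mem_univ,
    if_true, Pi.add_apply, mul_sub, Finset.sum_sub_distrib, mul_assoc, add_comm x₀]
  ring

lemma tendstoUniformlyOn_eval_differenceQuotient (hσ : HasDerivAt σ σ' x₀) (hc : σ c ≠ 0)
    (A : Matrix (Fin N) (Fin n) ℝ) (b : Fin N → ℝ) {s : Set (Fin n → ℝ)}
    (hs : Bornology.IsBounded s) :
    TendstoUniformlyOn (fun δ => (differenceQuotient σ c x₀ δ A b).eval σ)
      (fun z => A *ᵥ (σ' • z) + b) (𝓝[≠] 0) s := by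
  have hquot := tendstoUniformlyOn_inv_smul_sub_of_hasFDerivAt
    (hasFDerivAt_pi_apply_const (ι := Fin n) hσ) hs
  have haff : UniformContinuous fun z => A *ᵥ z + b :=
    (A.mulVecLin.toContinuousLinearMap.uniformContinuous).add uniformContinuous_const
  refine (haff.comp_tendstoUniformlyOn hquot).congr (.of_forall fun δ z _ => ?_)
  exact (eval_differenceQuotient hc x₀ δ A b z).symm

theorem exists_width_le_dist_eval_le (hσ : HasDerivAt σ σ' x₀) (hσ' : σ' ≠ 0)
    (A : Matrix (Fin N) (Fin n) ℝ) (b : Fin N → ℝ) {s : Set (Fin n → ℝ)}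
    (hs : Bornology.IsBounded s) {η : ℝ} (hη : 0 < η) :
    ∃ f : Network n N, f.width ≤ max (n + 1) N ∧
      ∀ z ∈ s, dist (f.eval σ z) (A *ᵥ z + b) ≤ η := by
  obtain ⟨c, hc⟩ : ∃ c, σ c ≠ 0 := by
    by_contra! hzero
    obtain rfl : σ = fun _ => 0 := funext hzero
    exact hσ' (hσ.unique (hasDerivAt_const x₀ 0))
  obtain ⟨δ, hδ⟩ := (Metric.tendstoUniformlyOn_iff.1
    (tendstoUniformlyOn_eval_differenceQuotient hσ hc (σ'⁻¹ • A) b hs) η hη).exists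
  refine ⟨differenceQuotient σ c x₀ δ (σ'⁻¹ • A) b, (width_differenceQuotient ..).le,
    fun z hz => ?_⟩
  have hlim : (σ'⁻¹ • A) *ᵥ (σ' • z) = A *ᵥ z := by
    rw [Matrix.smul_mulVec, Matrix.mulVec_smul, inv_smul_smul₀ hσ']
  rw [← hlim, dist_comm]
  exact (hδ z hz).le

end Network

section Softmax

variable {N : ℕ}

lemma softmax_pos (w : Fin N → ℝ) (k : Fin N) : 0 < softmax w k :=
  div_pos (Real.exp_pos _) (Finset.sum_pos (fun _ _ => Real.exp_pos _) ⟨k, Finset.mem_univ k⟩)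

lemma sum_softmax [NeZero N] (w : Fin N → ℝ) : ∑ k, softmax w k = 1 := by
  have hpos : 0 < ∑ j, Real.exp (w j) :=
    Finset.sum_pos (fun _ _ => Real.exp_pos _) Finset.univ_nonempty
  simp only [softmax, ← Finset.sum_div]
  exact div_self hpos.ne'

lemma softmax_le_exp_sub (w : Fin N → ℝ) (j k : Fin N) :
    softmax w k ≤ Real.exp (w k - w j) := by
  rw [softmax, Real.exp_sub]
  gcongr
  exact Finset.single_le_sum (f := fun i => Real.exp (w i)) (fun i _ => (Real.exp_pos _).le)
    (Finset.mem_univ j)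

end Softmax

section Attention

lemma mulVec_add_eq_mul_norm_sq_sub_dist_sq {ι κ : Type*} [Fintype κ] (lam : ℝ)
    (c : ι → EuclideanSpace ℝ κ) (x : EuclideanSpace ℝ κ) (k : ι) :
    (Matrix.of (fun k i => 2 * lam * c k i) *ᵥ x.ofLp + fun k => -lam * ‖c k‖ ^ 2) k =
      lam * (‖x‖ ^ 2 - dist x (c k) ^ 2) := by
  rw [dist_eq_norm, norm_sub_sq_real, PiLp.inner_apply]
  simp only [Matrix.mulVec, dotProduct, Matrix.of_apply, Pi.add_apply, RCLike.inner_apply,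
    conj_trivial, mul_assoc, ← Finset.mul_sum]
  ring

lemma exists_fin_forall_exists_dist_lt {α : Type*} [PseudoMetricSpace α] {s : Set α}
    (hs : IsCompact s) {δ : ℝ} (hδ : 0 < δ) :
    ∃ (N : ℕ) (c : Fin N → α), (∀ k, c k ∈ s) ∧ ∀ x ∈ s, ∃ k, dist x (c k) < δ := by
  obtain ⟨t, hts, htfin, hcover⟩ := hs.finite_cover_balls hδ
  obtain ⟨N, c, -, rfl⟩ := htfin.fin_param
  refine ⟨N, c, Set.range_subset_iff.1 hts, fun x hx => ?_⟩
  simpa only [Set.biUnion_range, Set.mem_iUnion, Metric.mem_ball] using hcover hx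

lemma sum_mul_le_add_of_le_or_le {ι : Type*} {s : Finset ι} {p d : ι → ℝ} {η κ D : ℝ}
    (hp : ∀ i ∈ s, 0 ≤ p i) (hsum : ∑ i ∈ s, p i ≤ 1) (hd : ∀ i ∈ s, 0 ≤ d i)
    (hdD : ∀ i ∈ s, d i ≤ D) (hη : 0 ≤ η) (hκ : 0 ≤ κ) (h : ∀ i ∈ s, d i ≤ η ∨ p i ≤ κ) :
    ∑ i ∈ s, p i * d i ≤ η + s.card * (κ * D) := by
  have hterm : ∀ i ∈ s, p i * d i ≤ p i * η + κ * D := by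
    intro i hi
    have hpη : 0 ≤ p i * η := mul_nonneg (hp i hi) hη
    have hκD : 0 ≤ κ * D := mul_nonneg hκ ((hd i hi).trans (hdD i hi))
    rcases h i hi with hdη | hpκ
    · linarith [mul_le_mul_of_nonneg_left hdη (hp i hi)]
    · linarith [mul_le_mul hpκ (hdD i hi) (hd i hi) hκ]
  calc ∑ i ∈ s, p i * d i ≤ ∑ i ∈ s, (p i * η + κ * D) := Finset.sum_le_sum hterm
    _ = (∑ i ∈ s, p i) * η + s.card * (κ * D) := by
      rw [Finset.sum_add_distrib, Finset.sum_mul, Finset.sum_const, nsmul_eq_mul]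
    _ ≤ η + s.card * (κ * D) := by grw [mul_le_of_le_one_left hη hsum]

variable {n : ℕ} {σ : ℝ → ℝ} {σ' x₀ : ℝ}

lemma exists_network_softmax_le (hσ : HasDerivAt σ σ' x₀) (hσ' : σ' ≠ 0) {N : ℕ}
    (c : Fin N → Euc n) {X : Set (Euc n)} (hX : Bornology.IsBounded X) {r R κ : ℝ} (hr : 0 ≤ r)
    (hrR : r < R) (hκ : 0 < κ) :
    ∃ f : Network n N, f.width ≤ max (n + 1) N ∧ ∀ x ∈ X, ∀ j k,
      dist x (c j) ≤ r → R ≤ dist x (c k) → softmax (f.eval σ x.ofLp) k ≤ κ := by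
  have hR : 0 < R := hr.trans_lt hrR
  have hgap : 0 < R ^ 2 - r ^ 2 := sub_pos.2 (by gcongr)
  -- The allowed error `1` in each score costs `2` in a difference of scores.
  set lam : ℝ := (2 + |Real.log κ|) / (R ^ 2 - r ^ 2)
  have : 0 ≤ lam := by positivity
  have hbdd : Bornology.IsBounded (WithLp.ofLp '' X) :=
    (PiLp.lipschitzWith_ofLp 2 fun _ : Fin n => ℝ).isBounded_image hX
  obtain ⟨f, hwidth, hf⟩ := Network.exists_width_le_dist_eval_le hσ hσ'
    (Matrix.of fun k i => 2 * lam * c k i) (fun k => -lam * ‖c k‖ ^ 2) hbdd one_pos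
  refine ⟨f, hwidth, fun x hx j k hj hk => ?_⟩
  have hscore (l : Fin N) :
      |f.eval σ x.ofLp l - lam * (‖x‖ ^ 2 - dist x (c l) ^ 2)| ≤ 1 := by
    rw [← mulVec_add_eq_mul_norm_sq_sub_dist_sq, ← Real.dist_eq]
    exact (dist_le_pi_dist _ _ l).trans (hf _ (Set.mem_image_of_mem _ hx))
  have hdist : lam * (R ^ 2 - r ^ 2) ≤ lam * (dist x (c k) ^ 2 - dist x (c j) ^ 2) := by
    gcongr
  rw [div_mul_cancel₀ _ hgap.ne'] at hdist
  refine (softmax_le_exp_sub _ j k).trans ((Real.le_log_iff_exp_le hκ).1 ?_)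
  linarith [(abs_le.1 (hscore j)).1, (abs_le.1 (hscore k)).2, neg_abs_le (Real.log κ)]

theorem exists_network_sum_softmax_mul_dist_le {α : Type*} [PseudoMetricSpace α]
    (hσ : HasDerivAt σ σ' x₀) (hσ' : σ' ≠ 0) {X : Set (Euc n)} (hX : IsCompact X)
    (hne : X.Nonempty) {g : Euc n → α} (hg : ContinuousOn g X) {ε : ℝ} (hε : 0 < ε) :
    ∃ N, 0 < N ∧ ∃ (f : Network n N) (c : Fin N → Euc n), f.width ≤ max (n + 1) N ∧
      (∀ k, c k ∈ X) ∧
      ∀ x ∈ X, ∑ k, softmax (f.eval σ x.ofLp) k * dist (g (c k)) (g x) ≤ ε := by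
  obtain ⟨δ, hδ, hosc⟩ := Metric.uniformContinuousOn_iff_le.1
    (hX.uniformContinuousOn_of_continuous hg) (ε / 2) (half_pos hε)
  obtain ⟨N, c, hcX, hnet⟩ := exists_fin_forall_exists_dist_lt hX (half_pos hδ)
  obtain ⟨j₀, -⟩ := hnet _ hne.some_mem
  have : NeZero N := ⟨j₀.pos.ne'⟩
  set D := Metric.diam (g '' X)
  have : 0 ≤ D := Metric.diam_nonneg
  have hdist : ∀ x ∈ X, ∀ y ∈ X, dist (g x) (g y) ≤ D := fun x hx y hy =>
    Metric.dist_le_diam_of_mem (hX.image_of_continuousOn hg).isBounded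
      (Set.mem_image_of_mem g hx) (Set.mem_image_of_mem g hy)
  set κ := ε / 2 / (N * D + 1)
  have hκ : 0 < κ := by positivity
  obtain ⟨f, hwidth, hfar⟩ :=
    exists_network_softmax_le hσ hσ' c hX.isBounded (half_pos hδ).le (half_lt_self hδ) hκ
  refine ⟨N, j₀.pos, f, c, hwidth, hcX, fun x hx => ?_⟩
  obtain ⟨j, hj⟩ := hnet x hx
  have hsplit (k : Fin N) : dist (g (c k)) (g x) ≤ ε / 2 ∨ softmax (f.eval σ x.ofLp) k ≤ κ := by
    rcases le_total (dist (c k) x) δ with hk | hk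
    · exact .inl (hosc _ (hcX k) x hx hk)
    · exact .inr (hfar x hx j k hj.le (by rwa [dist_comm]))
  calc ∑ k, softmax (f.eval σ x.ofLp) k * dist (g (c k)) (g x)
      ≤ ε / 2 + (Finset.univ : Finset (Fin N)).card * (κ * D) :=
        sum_mul_le_add_of_le_or_le (fun k _ => (softmax_pos _ k).le) (sum_softmax _).le
          (fun _ _ => dist_nonneg) (fun k _ => hdist _ (hcX k) x hx) (half_pos hε).le hκ.le
          fun k _ => hsplit k
    _ = ε / 2 + κ * (N * D) := by rw [Finset.card_fin]; ring
    _ ≤ ε / 2 + κ * (N * D + 1) := by gcongr; exact le_add_of_nonneg_right zero_le_one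
    _ = ε := by rw [div_mul_cancel₀ _ (by positivity), add_halves]

end Attention

section PAttention

variable {N Q m : ℕ} (w : Fin N → ℝ) (Y : Fin N → Fin Q → Euc m)

lemma lintegral_pAttention (g : Euc m → ℝ≥0∞) :
    ∫⁻ z, g z ∂(pAttention w Y) =
      (Q : ℝ≥0∞)⁻¹ * ∑ k, ∑ q, ENNReal.ofReal (softmax w k) * g (Y k q) := by
  simp only [pAttention, lintegral_smul_measure, lintegral_finsetSum_measure, lintegral_dirac,
    smul_eq_mul]

lemma lintegral_edist_pAttention (Y : Fin N → Fin 1 → Euc m) (b : Euc m) :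
    ∫⁻ z, edist z b ∂(pAttention w Y) =
      ENNReal.ofReal (∑ k, softmax w k * dist (Y k 0) b) := by
  rw [ENNReal.ofReal_sum_of_nonneg fun k _ => mul_nonneg (softmax_pos w k).le dist_nonneg]
  simp only [lintegral_pAttention, Fin.sum_univ_one, Nat.cast_one, inv_one, one_mul, edist_dist,
    ENNReal.ofReal_mul (softmax_pos w _).le]

lemma integrable_pAttention [NeZero Q] {E : Type*} [NormedAddCommGroup E] (g : Euc m → E) :
    Integrable g (pAttention w Y) := by
  refine .smul_measure ?_ (ENNReal.inv_ne_top.2 (Nat.cast_ne_zero.2 (NeZero.ne Q)))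
  refine integrable_finsetSum_measure.2 fun k _ => integrable_finsetSum_measure.2 fun q _ => ?_
  exact (integrable_dirac enorm_lt_top).smul_measure ENNReal.ofReal_ne_top

lemma integral_pAttention {E : Type*} [NormedAddCommGroup E] [NormedSpace ℝ E]
    [CompleteSpace E] (g : Euc m → E) :
    ∫ z, g z ∂(pAttention w Y) = (Q : ℝ)⁻¹ • ∑ k, ∑ q, softmax w k • g (Y k q) := by
  have hint (k : Fin N) (q : Fin Q) :
      Integrable g (ENNReal.ofReal (softmax w k) • Measure.dirac (Y k q)) :=
    (integrable_dirac enorm_lt_top).smul_measure ENNReal.ofReal_ne_top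
  rw [pAttention, integral_smul_measure, integral_finsetSum_measure
    fun k _ => integrable_finsetSum_measure.2 fun q _ => hint k q]
  simp only [integral_finsetSum_measure fun q _ => hint _ q, integral_smul_measure,
    integral_dirac, ENNReal.toReal_ofReal (softmax_pos w _).le, ENNReal.toReal_inv,
    ENNReal.toReal_natCast]

lemma integral_id_pAttention : ∫ z, z ∂(pAttention w Y) = attention w (averagedParticles Y) := by
  simp only [integral_pAttention, attention, averagedParticles, Finset.smul_sum]
  exact Finset.sum_congr rfl fun k _ => Finset.sum_congr rfl fun q _ => smul_comm _ _ _

lemma isProbabilityMeasure_pAttention [NeZero N] [NeZero Q] :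
    IsProbabilityMeasure (pAttention w Y) := by
  constructor
  rw [← lintegral_one, lintegral_pAttention]
  simp only [mul_one, Finset.sum_const, Finset.card_univ, Fintype.card_fin, nsmul_eq_mul]
  rw [← Finset.mul_sum, ← ENNReal.ofReal_sum_of_nonneg fun k _ => (softmax_pos w k).le,
    sum_softmax, ENNReal.ofReal_one, mul_one]
  exact ENNReal.inv_mul_cancel (Nat.cast_ne_zero.2 (NeZero.ne Q)) (ENNReal.natCast_ne_top Q)

lemma mem_support_pAttention (k : Fin N) (q : Fin Q) : Y k q ∈ (pAttention w Y).support := by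
  refine (Measure.mem_support_iff_forall _).2 fun U hU => ?_
  have hterm : 0 < ENNReal.ofReal (softmax w k) * Measure.dirac (Y k q) U := by
    rw [Measure.dirac_apply_of_mem (mem_of_mem_nhds hU), mul_one]
    exact ENNReal.ofReal_pos.2 (softmax_pos w k)
  simp only [pAttention, Measure.smul_apply, Measure.coe_finsetSum, Finset.sum_apply, smul_eq_mul]
  refine ENNReal.mul_pos (ENNReal.inv_ne_zero.2 (ENNReal.natCast_ne_top Q)) (ne_of_gt ?_)
  exact Finset.sum_pos_iff.2
    ⟨k, Finset.mem_univ k, Finset.sum_pos_iff.2 ⟨q, Finset.mem_univ q, hterm⟩⟩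

lemma support_pAttention_subset {K : Set (Euc m)} (hK : IsClosed K) (hY : ∀ k q, Y k q ∈ K) :
    (pAttention w Y).support ⊆ K := by
  refine Measure.support_subset_of_isClosed hK ?_
  rw [mem_ae_iff]
  simp [pAttention, Measure.dirac_apply' _ hK.measurableSet.compl, hY]

lemma attention_averagedParticles_mem [NeZero N] [NeZero Q] {K : Set (Euc m)} (hK : Convex ℝ K)
    (hY : ∀ k q, Y k q ∈ K) : attention w (averagedParticles Y) ∈ K := by
  have hQ : ∑ _q : Fin Q, (Q : ℝ)⁻¹ = 1 := by
    rw [Fin.sum_const, nsmul_eq_mul, mul_inv_cancel₀ (Nat.cast_ne_zero.2 (NeZero.ne Q))]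
  refine hK.sum_mem (fun k _ => (softmax_pos w k).le) (sum_softmax w) fun k _ => ?_
  rw [averagedParticles, Finset.smul_sum]
  exact hK.sum_mem (fun _ _ => by positivity) hQ fun q _ => hY k q

end PAttention

section Wasserstein

lemma ae_snd_eq_of_map_snd_eq_dirac {α β : Type*} [MeasurableSpace α] [MeasurableSpace β]
    [MeasurableSingletonClass β] {π : Measure (α × β)} {b : β}
    (hπ : π.map Prod.snd = Measure.dirac b) : ∀ᵐ p ∂π, p.2 = b := by
  have hdirac : ∀ᵐ z ∂(π.map Prod.snd), z = b := by
    rw [hπ]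
    exact (ae_dirac_iff (measurableSet_singleton b)).2 rfl
  exact ae_of_ae_map measurable_snd.aemeasurable hdirac

variable {m : ℕ} (μ : Measure (Euc m)) [IsProbabilityMeasure μ] (b : Euc m)

lemma W1_dirac : W1 μ (Measure.dirac b) = ∫⁻ z, edist z b ∂μ := by
  refine le_antisymm ?_ (le_iInf₂ fun π ⟨hfst, hsnd⟩ => ?_)
  · have hfst : (μ.prod (Measure.dirac b)).map Prod.fst = μ := by
      rw [Measure.map_fst_prod, measure_univ, one_smul]
    have hsnd : (μ.prod (Measure.dirac b)).map Prod.snd = Measure.dirac b := by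
      rw [Measure.map_snd_prod, measure_univ, one_smul]
    calc W1 μ (Measure.dirac b) ≤ ∫⁻ p, edist p.1 p.2 ∂(μ.prod (Measure.dirac b)) :=
          iInf₂_le _ ⟨hfst, hsnd⟩
      _ = ∫⁻ z, edist z b ∂μ := by
        rw [Measure.prod_dirac, lintegral_map (by fun_prop) (by fun_prop)]
  · rw [← hfst, lintegral_map (by fun_prop) measurable_fst]
    refine (lintegral_congr_ae ?_).le
    filter_upwards [ae_snd_eq_of_map_snd_eq_dirac hsnd] with p hp
    rw [hp]

lemma W1ToSet_singleton : W1ToSet μ {b} = ∫⁻ z, edist z b ∂μ := by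
  rw [W1ToSet, iInf_singleton, W1_dirac]

end Wasserstein

lemma edist_integral_le_lintegral_edist {Ω E : Type*} [MeasurableSpace Ω] [NormedAddCommGroup E]
    [NormedSpace ℝ E] [CompleteSpace E] {μ : Measure Ω} [IsProbabilityMeasure μ] {Z : Ω → E}
    (hZ : Integrable Z μ) (b : E) : edist (∫ ω, Z ω ∂μ) b ≤ ∫⁻ ω, edist (Z ω) b ∂μ := by
  have hsub : (∫ ω, Z ω ∂μ) - b = ∫ ω, (Z ω - b) ∂μ := by
    rw [integral_sub hZ (integrable_const b), integral_const, probReal_univ, one_smul]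
  simp only [edist_eq_enorm_sub, hsub]
  exact enorm_integral_le_lintegral_enorm _

namespace ProbablyApproximatelyOptimal

variable {n m N Q : ℕ} {σ : ℝ → ℝ} {K : Set (Euc m)} {C : Euc n → Set (Euc m)}
  {L : Euc n → Euc m → ℝ} {P : Measure (Euc n)} {ε : ℝ}

theorem exists_of_measurable {σ' x₀ : ℝ} (hσ : HasDerivAt σ σ' x₀) (hσ' : σ' ≠ 0)
    (hK : IsClosed K) [IsProbabilityMeasure P] {ystar : Euc n → Euc m} (hmeas : Measurable ystar)
    (hy : ∀ x, argminOn (L x) (C x ∩ K) = {ystar x}) (hε : 0 < ε) :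
    ∃ N : ℕ, 0 < N ∧ ∃ (f : Network n N) (Y : Fin N → Fin 1 → Euc m) (X : Set (Euc n)),
      ProbablyApproximatelyOptimal σ K C L P ε f Y X := by
  obtain ⟨X, hX, hPX, hcont⟩ := exists_isCompact_measure_compl_lt_continuousOn P hmeas
    (ε := min (ENNReal.ofReal ε) 1) (by simpa using hε)
  have hPX' := lt_min_iff.1 hPX
  have hne : X.Nonempty := by
    rw [Set.nonempty_iff_ne_empty]
    rintro rfl
    simp at hPX'
  have hprob : 1 - P.real X ≤ ε := by
    rw [← probReal_compl_eq_one_sub hX.measurableSet]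
    exact ENNReal.toReal_le_of_le_ofReal hε.le hPX'.1.le
  obtain ⟨N, hN, f, c, hwidth, -, hf⟩ :=
    exists_network_sum_softmax_mul_dist_le hσ hσ' hX hne hcont hε
  have : NeZero N := ⟨hN.ne'⟩
  have hmem (x : Euc n) : ystar x ∈ argminOn (L x) (C x ∩ K) := hy x ▸ rfl
  refine ⟨N, hN, f, fun k _ => ystar (c k), X, by omega, ?_, hX, fun x hx => ?_, hprob⟩
  · exact Set.iUnion_subset fun x => support_pAttention_subset _ _ hK fun k _ => (hmem (c k)).1.2
  · have := isProbabilityMeasure_pAttention (f.eval σ x.ofLp) fun k (_ : Fin 1) => ystar (c k)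
    rw [hy x, model, W1ToSet_singleton, lintegral_edist_pAttention]
    exact ENNReal.ofReal_le_ofReal (hf x hx)

variable {f : Network n N} {Y : Fin N → Fin Q → Euc m} {X : Set (Euc n)}

lemma particle_mem (h : ProbablyApproximatelyOptimal σ K C L P ε f Y X) (k : Fin N) (q : Fin Q) :
    Y k q ∈ K :=
  h.support_subset (Set.mem_iUnion_of_mem 0 (mem_support_pAttention _ Y k q))

lemma lintegral_edist_model_le [NeZero N] [NeZero Q]
    (h : ProbablyApproximatelyOptimal σ K C L P ε f Y X) {x : Euc n} (hx : x ∈ X) {b : Euc m}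
    (hb : argminOn (L x) (C x ∩ K) = {b}) :
    ∫⁻ z, edist z b ∂(model σ f Y x) ≤ ENNReal.ofReal ε := by
  have : IsProbabilityMeasure (model σ f Y x) := isProbabilityMeasure_pAttention _ Y
  rw [← W1ToSet_singleton, ← hb]
  exact h.optimal x hx

end ProbablyApproximatelyOptimal

section HasLaw

variable {n m N Q : ℕ} {σ : ℝ → ℝ} {f : Network n N} {Y : Fin N → Fin Q → Euc m} {x : Euc n}
  {Ω : Type*} [MeasurableSpace Ω] {μ : Measure Ω} {Z : Ω → Euc m}

lemma integrable_of_hasLaw_model [NeZero Q] (hZ : HasLaw Z (model σ f Y x) μ) :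
    Integrable Z μ := by
  have hid := integrable_pAttention (f.eval σ x.ofLp) Y (id : Euc m → Euc m)
  rw [← model, ← hZ.map_eq] at hid
  exact hid.comp_aemeasurable hZ.aemeasurable

lemma integral_eq_attention_of_hasLaw_model (hZ : HasLaw Z (model σ f Y x) μ) :
    ∫ ω, Z ω ∂μ = attention (f.eval σ x.ofLp) (averagedParticles Y) :=
  hZ.integral_eq.trans (integral_id_pAttention _ _)

end HasLaw

theorem mainTheorem7_general {n m : ℕ} {σ : ℝ → ℝ} {σ' x₀ : ℝ} (hσ : HasDerivAt σ σ' x₀)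
    (hσ' : σ' ≠ 0) {K : Set (Euc m)} (hK : IsCompact K) {C : Euc n → Set (Euc m)}
    (hC : WeaklyMeasurableCorrespondence K C) (hCK : ∀ x, IsClosed (C x ∩ K))
    {L : Euc n → Euc m → ℝ} (hLcont : ∀ x, ContinuousOn (L x) K)
    (hLmeas : ∀ y ∈ K, Measurable fun x => L x y) (P : Measure (Euc n)) [IsProbabilityMeasure P]
    {ystar : Euc n → Euc m} (hy : ∀ x, argminOn (L x) (C x ∩ K) = {ystar x})
    {ε : ℝ} (hε : 0 < ε) :
    (∃ N : ℕ, 0 < N ∧ ∃ (f : Network n N) (Y : Fin N → Fin 1 → Euc m) (X : Set (Euc n)),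
      ProbablyApproximatelyOptimal σ K C L P ε f Y X) ∧
    ∀ (N Q : ℕ), 0 < N → 0 < Q →
      ∀ (f : Network n N) (Y : Fin N → Fin Q → Euc m) (X : Set (Euc n)),
      ProbablyApproximatelyOptimal σ K C L P ε f Y X →
      ∀ (Ω : Type*) [MeasurableSpace Ω] (μ : Measure Ω) [IsProbabilityMeasure μ]
        (Z : Euc n → Ω → Euc m), (∀ x, HasLaw (Z x) (model σ f Y x) μ) →
        (∀ x, Integrable (Z x) μ ∧
          ∫ ω, Z x ω ∂μ = attention (f.eval σ x.ofLp) (averagedParticles Y)) ∧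
        (Convex ℝ K → ∀ x, ∫ ω, Z x ω ∂μ ∈ K) ∧
        (∀ x ∈ X, ‖(∫ ω, Z x ω ∂μ) - ystar x‖ ≤ ε) := by
  refine ⟨ProbablyApproximatelyOptimal.exists_of_measurable hσ hσ' hK.isClosed
    (measurable_of_argminOn_eq_singleton hK hC hCK hLcont hLmeas hy) hy hε, ?_⟩
  intro N Q hN hQ f Y X hopt Ω _ μ _ Z hZ
  have : NeZero N := ⟨hN.ne'⟩
  have : NeZero Q := ⟨hQ.ne'⟩
  have hint (x : Euc n) : Integrable (Z x) μ := integrable_of_hasLaw_model (hZ x)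
  have hmean (x : Euc n) := integral_eq_attention_of_hasLaw_model (hZ x)
  refine ⟨fun x => ⟨hint x, hmean x⟩, fun hKconv x => ?_, fun x hx => ?_⟩
  · rw [hmean x]
    exact attention_averagedParticles_mem _ Y hKconv hopt.particle_mem
  · rw [← dist_eq_norm, ← edist_le_ofReal hε.le]
    calc edist (∫ ω, Z x ω ∂μ) (ystar x) ≤ ∫⁻ ω, edist (Z x ω) (ystar x) ∂μ :=
          edist_integral_le_lintegral_edist (E := Euc m) (hint x) (ystar x)
      _ = ∫⁻ z, edist z (ystar x) ∂(model σ f Y x) :=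
          (hZ x).lintegral_comp (f := fun z => edist z (ystar x)) (by fun_prop)
      _ ≤ ENNReal.ofReal ε := hopt.lintegral_edist_model_le hx (hy x)

theorem mainTheorem7 {n m : ℕ} (σ : ℝ → ℝ) (hσ : AdmissibleActivation σ)
    (K : Set (Euc m)) (hKne : K.Nonempty) (hK : IsCompact K)
    (C : Euc n → Set (Euc m)) (hC : WeaklyMeasurableCorrespondence K C)
    (hCclosed : ∀ x, IsClosed (C x)) (hCK : ∀ x, (C x ∩ K).Nonempty)
    (L : Euc n → Euc m → ℝ) (hLcont : ∀ x, Continuous (L x))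
    (hLmeas : ∀ y, Measurable (fun x => L x y))
    (P : Measure (Euc n)) [IsProbabilityMeasure P]
    (hconv : ∀ x, Convex ℝ (C x ∩ K)) (hL : ∀ x, StrictConvexOn ℝ Set.univ (L x)) :
    ∃ ystar : Euc n → Euc m,
      -- `ystar x` is the unique minimizer of `L x` on `C x ∩ K`
      (∀ x, argminOn (L x) (C x ∩ K) = {ystar x}) ∧
      ∀ ε : ℝ, 0 < ε → ε ≤ 1 →
        -- there is a model with an `N × m` matrix of particles
        (∃ N : ℕ, 0 < N ∧ ∃ (f : Network n N) (Y : Fin N → Fin 1 → Euc m) (X : Set (Euc n)),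
          ProbablyApproximatelyOptimal σ K C L P ε f Y X) ∧
        -- the mean of every such model, also with an `N × Q × m` array of particles
        ∀ (N Q : ℕ), 0 < N → 0 < Q →
          ∀ (f : Network n N) (Y : Fin N → Fin Q → Euc m) (X : Set (Euc n)),
          ProbablyApproximatelyOptimal σ K C L P ε f Y X →
          ∀ (Ω : Type*) [MeasurableSpace Ω] (μ : Measure Ω) [IsProbabilityMeasure μ]
            (Z : Euc n → Ω → Euc m), (∀ x, HasLaw (Z x) (model σ f Y x) μ) →
            (∀ x, Integrable (Z x) μ ∧
              ∫ ω, Z x ω ∂μ = attention (f.eval σ x.ofLp) (averagedParticles Y)) ∧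
            (Convex ℝ K → ∀ x, ∫ ω, Z x ω ∂μ ∈ K) ∧
            (∀ x ∈ X, ‖(∫ ω, Z x ω ∂μ) - ystar x‖ ≤ ε) := by
  obtain ⟨-, x₀, hd, hd₀⟩ := hσ
  choose ystar hy using fun x => exists_argminOn_eq_singleton (hK.inter_left (hCclosed x)) (hCK x)
    ((hLcont x).lowerSemicontinuous.lowerSemicontinuousOn _)
    ((hL x).subset (Set.subset_univ _) (hconv x))
  exact ⟨ystar, hy, fun ε hε _ => mainTheorem7_general hd.hasDerivAt hd₀ hK hC
    (fun x => (hCclosed x).inter hK.isClosed) (fun x => (hLcont x).continuousOn)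
    (fun y _ => hLmeas y) P hy hε⟩
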